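/- **Theorem 5.7.** Let $H_3(\mathbb R)$ be the Heisenberg group of real matrices $\begin{pmatrix}1&x&z\\0&1&y\\0&0&1\end{pmatrix}$ with its natural topology. Let $p:H_3(\mathbb R)\to\mathbb R^2$ map this matrix to $(x,y)$, and let $c(t)$ denote the matrix with $x=y=0$, $z=t$. A lattice is a discrete subgroup of finite covolume. For a lattice $\Lambda$ in $H_3(\mathbb R)$, let $\xi_\Lambda>0$ be the real number with $\Lambda\cap\{c(t):t\in\mathbb R\}=\{c(m\xi_\Lambda):m\in\mathbb Z\}$, and let $p(\Lambda)^*=\{w\in\mathbb R^2:\langle w,v\rangle\in\mathbb Z\text{ for all }v\in p(\Lambda)\}$ be the dual lattice of $p(\Lambda)$. The odometer associated with a nested sequence $\Gamma_1\supset\Gamma_2\supset\cdots$ of lattices in $H_3(\mathbb R)$ is the action of $H_3(\mathbb R)$ by left translations on the inverse limit of the homogeneous spaces $H_3(\mathbb R)/\Gamma_1\leftarrow H_3(\mathbb R)/\Gamma_2\leftarrow\cdots$, equipped with its (unique) invariant Borel probability measure. A probability preserving action is said to be associated with $(\Gamma_j)_{j\ge1}$ if it is measure-theoretically isomorphic to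 this odometer. Two $H_3(\mathbb R)$-odometers $T,T'$ are called f-isomorphic if they are associated with some nested sequences $(\Delta_j)_{j\ge1}$ and $(\Delta'_j)_{j\ge1}$ of lattices, respectively, such that $\Delta_j$ and $\Delta'_j$ are conjugate in $H_3(\mathbb R)$ for every $j$. Let $\Gamma=(\Gamma_j)_{j\ge1}$ and $\Gamma'=(\Gamma'_j)_{j\ge1}$ be two nested (decreasing) sequences of lattices in $H_3(\mathbb R)$, and let $T$ and $T'$ be the odometers associated with $\Gamma$ and $\Gamma'$. Put $$S_\Gamma:=\bigcup_{j\ge1}p(\Gamma_j)^*\subset\mathbb R^2,\qquad \xi_\Gamma:=\bigcup_{j\ge1}\xi_{\Gamma_j}^{-1}\mathbb Z\subset\mathbb R,$$ and define $S_{\Gamma'}$, $\xi_{\Gamma'}$ in the same way. Then $T$ and $T'$ are f-isomorphic if and only if $S_\Gamma=S_{\Gamma'}$ and $\xi_\Gamma=\xi_{\Gamma'}$. -/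

import Mathlib

open MeasureTheory

/-! ### Lattices, odometers and f-isomorphism for a topological group -/

section Odometers

theorem quotientMapOfLE_smul {G : Type*} [Group G] {s t : Subgroup G} (h : s ≤ t) (g : G)
    (q : G ⧸ s) :
    Subgroup.quotientMapOfLE h (g • q) = g • Subgroup.quotientMapOfLE h q := by
  induction q using QuotientGroup.induction_on
  rfl

variable {G : Type*} [Group G] [MeasurableSpace G]

/-- A lattice: a discrete subgroup `Γ` of finite covolume, that is, such that the homogeneous space
`G ⧸ Γ` carries a finite nonzero (here normalized) measure invariant under left translations.
(`G ⧸ Γ` has the quotient σ-algebra, which is the Borel σ-algebra for a discrete subgroup of a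
second countable locally compact group.) -/
def IsLattice [TopologicalSpace G] (Γ : Subgroup G) : Prop :=
  DiscreteTopology Γ ∧
    ∃ ν : Measure (G ⧸ Γ), IsProbabilityMeasure ν ∧ SMulInvariantMeasure G (G ⧸ Γ) ν

/-- A nested sequence `Γ 0 ⊇ Γ 1 ⊇ Γ 2 ⊇ ⋯` of lattices in `G`. -/
structure LatticeSeq (G : Type*) [Group G] [MeasurableSpace G] [TopologicalSpace G] where
  lat : ℕ → Subgroup G
  isLattice : ∀ n, IsLattice (lat n)
  nested : ∀ n, lat (n + 1) ≤ lat n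

/-- The phase space of the odometer: the inverse limit of the homogeneous spaces
`G ⧸ Γ 0 ← G ⧸ Γ 1 ← G ⧸ Γ 2 ← ⋯` along the natural projections `g Γ (n+1) ↦ g Γ n`. -/
def OdometerSpace [TopologicalSpace G] (Γ : LatticeSeq G) : Type _ :=
  {x : ∀ n, G ⧸ Γ.lat n // ∀ n, Subgroup.quotientMapOfLE (Γ.nested n) (x (n + 1)) = x n}

/-- The σ-algebra on the inverse limit, generated by the coordinate projections to the
spaces `G ⧸ Γ n`. -/
instance [TopologicalSpace G] (Γ : LatticeSeq G) : MeasurableSpace (OdometerSpace Γ) :=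
  Subtype.instMeasurableSpace

/-- The action of `G` on the inverse limit by rotations (left translations) in every coordinate. -/
instance [TopologicalSpace G] (Γ : LatticeSeq G) : MulAction G (OdometerSpace Γ) where
  smul g x := ⟨fun n => g • x.1 n, fun n => by rw [quotientMapOfLE_smul, x.2 n]⟩
  one_smul x := Subtype.ext (funext fun n => one_smul G (x.1 n))
  mul_smul g h x := Subtype.ext (funext fun n => mul_smul g h (x.1 n))

/-- Measure-theoretic isomorphism of two measure preserving `G`-actions on `(X, μ)` and `(Y, ν)`:
a measure preserving map, invertible modulo null sets, that intertwines the two actions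
almost everywhere. -/
def MeasureIsomorphic (G : Type*) [Group G] {X Y : Type*} [MeasurableSpace X] [MulAction G X]
    [MeasurableSpace Y] [MulAction G Y] (μ : Measure X) (ν : Measure Y) : Prop :=
  ∃ (φ : X → Y) (ψ : Y → X),
    MeasurePreserving φ μ ν ∧ MeasurePreserving ψ ν μ ∧
    (∀ᵐ x ∂μ, ψ (φ x) = x) ∧ (∀ᵐ y ∂ν, φ (ψ y) = y) ∧
    ∀ g : G, ∀ᵐ x ∂μ, φ (g • x) = g • φ x

/-- `m` is the measure of the odometer: an invariant probability measure on the inverse limit.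
The odometers are uniquely ergodic, so that `Γ` determines `m`; it is the inverse limit of the
normalized Haar measures of the spaces `G ⧸ Γ n`. -/
def IsOdometerMeasure [TopologicalSpace G] (Γ : LatticeSeq G) (m : Measure (OdometerSpace Γ)) :
    Prop :=
  IsProbabilityMeasure m ∧ SMulInvariantMeasure G (OdometerSpace Γ) m

/-- The `G`-action on `(X, μ)` is (isomorphic to) the odometer associated with the sequence `Δ`. -/
def IsAssociatedWith [TopologicalSpace G] {X : Type*} [MeasurableSpace X] [MulAction G X]
    (μ : Measure X) (Δ : LatticeSeq G) : Prop :=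
  ∃ m : Measure (OdometerSpace Δ), IsOdometerMeasure Δ m ∧ MeasureIsomorphic G μ m

/-- Two `G`-actions, on `(X, μ)` and on `(Y, ν)`, are f-isomorphic if they are associated with
nested sequences of lattices `Δ` and `Δ'` respectively such that `Δ j` and `Δ' j` are conjugate
in `G` for every `j`. -/
def FIsomorphic (G : Type*) [Group G] [MeasurableSpace G] [TopologicalSpace G] {X Y : Type*}
    [MeasurableSpace X] [MulAction G X] [MeasurableSpace Y] [MulAction G Y]
    (μ : Measure X) (ν : Measure Y) : Prop :=
  ∃ Δ Δ' : LatticeSeq G, IsAssociatedWith μ Δ ∧ IsAssociatedWith ν Δ' ∧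
    ∀ j, ∃ g : G, Δ'.lat j = (Δ.lat j).map (MulAut.conj g).toMonoidHom

end Odometers

/-! ### The Heisenberg group and the invariants of its odometers -/

/-- The real Heisenberg group: `⟨x, y, z⟩` is the upper triangular matrix with rows
`(1, x, z)`, `(0, 1, y)`, `(0, 0, 1)`. -/
@[ext]
structure Heis where
  x : ℝ
  y : ℝ
  z : ℝ

namespace Heis

def toMatrix (g : Heis) : Matrix (Fin 3) (Fin 3) ℝ :=
  !![1, g.x, g.z; 0, 1, g.y; 0, 0, 1]

instance : Group Heis where
  mul g h := ⟨g.x + h.x, g.y + h.y, g.z + h.z + g.x * h.y⟩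
  one := ⟨0, 0, 0⟩
  inv g := ⟨-g.x, -g.y, -g.z + g.x * g.y⟩
  mul_assoc g h k := by
    refine Heis.ext (add_assoc _ _ _) (add_assoc _ _ _) ?_
    change g.z + h.z + g.x * h.y + k.z + (g.x + h.x) * k.y
      = g.z + (h.z + k.z + h.x * k.y) + g.x * (h.y + k.y)
    ring
  one_mul g := by
    refine Heis.ext (zero_add _) (zero_add _) ?_
    change 0 + g.z + 0 * g.y = g.z
    ring
  mul_one g := by
    refine Heis.ext (add_zero _) (add_zero _) ?_
    change g.z + 0 + g.x * 0 = g.z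
    ring
  inv_mul_cancel g := by
    refine Heis.ext (neg_add_cancel _) (neg_add_cancel _) ?_
    change -g.z + g.x * g.y + g.z + -g.x * g.y = 0
    ring

/-- The group operation is the product of matrices. -/
theorem toMatrix_mul (g h : Heis) : (g * h).toMatrix = g.toMatrix * h.toMatrix := by
  have hx : (g * h).x = g.x + h.x := rfl
  have hy : (g * h).y = g.y + h.y := rfl
  have hz : (g * h).z = g.z + h.z + g.x * h.y := rfl
  ext i j
  fin_cases i <;> fin_cases j <;>
    simp [toMatrix, Matrix.mul_apply, Fin.sum_univ_three, hx, hy, hz] <;> ring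

/-- The natural topology, that of `ℝ³`. -/
instance : TopologicalSpace Heis :=
  TopologicalSpace.induced (fun g : Heis => (g.x, g.y, g.z)) inferInstance

instance : MeasurableSpace Heis := borel Heis

instance : BorelSpace Heis := ⟨rfl⟩

/-- The one-parameter central subgroup. -/
def c (t : ℝ) : Heis := ⟨0, 0, t⟩

/-- The projection of the Heisenberg group onto `ℝ²` whose kernel is the center. -/
def p (g : Heis) : ℝ × ℝ := (g.x, g.y)

end Heis

/-- The dual lattice `L* = {w | ⟨w, v⟩ ∈ ℤ for all v ∈ L}` of a lattice `L` in `ℝ²`. -/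
def dualLattice (L : Set (ℝ × ℝ)) : Set (ℝ × ℝ) :=
  {w | ∀ v ∈ L, ∃ m : ℤ, w.1 * v.1 + w.2 * v.2 = m}

/-- The positive generator `ξ` of the center of a lattice: `Γ ∩ {c(t)} = {c(m ξ) | m ∈ ℤ}`;
see `centralGenerator_eq`. -/
noncomputable def centralGenerator (Γ : Subgroup Heis) : ℝ :=
  sInf {t : ℝ | 0 < t ∧ Heis.c t ∈ Γ}

theorem centralGenerator_eq {Γ : Subgroup Heis} {r : ℝ} (hr : 0 < r)
    (h : ∀ t : ℝ, Heis.c t ∈ Γ ↔ ∃ m : ℤ, t = m * r) : centralGenerator Γ = r := by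
  have hl : IsLeast {t : ℝ | 0 < t ∧ Heis.c t ∈ Γ} r := by
    refine ⟨⟨hr, (h r).2 ⟨1, by simp⟩⟩, ?_⟩
    rintro t ⟨ht, hc⟩
    obtain ⟨m, rfl⟩ := (h t).1 hc
    have hm : (0 : ℝ) < m := pos_of_mul_pos_left ht hr.le
    have hm1 : (1 : ℝ) ≤ m := by exact_mod_cast Int.cast_pos.1 hm
    nlinarith
  exact hl.csInf_eq

/-- `S_Γ = ⋃ j, p(Γ j)*`, in `ℝ²`. -/
def invariantS (Γ : LatticeSeq Heis) : Set (ℝ × ℝ) :=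
  ⋃ j, dualLattice (Heis.p '' (Γ.lat j : Set Heis))

/-- `ξ_Γ = ⋃ j, ξ_{Γ j}⁻¹ ℤ`, in `ℝ`. -/
noncomputable def invariantXi (Γ : LatticeSeq Heis) : Set ℝ :=
  ⋃ j, {s : ℝ | ∃ m : ℤ, s = (centralGenerator (Γ.lat j))⁻¹ * m}

/-! ### Measure isomorphism and transport of eigenfunctions -/

section Isomorphism

variable {G : Type*} [Group G] {X Y : Type*} [MeasurableSpace X] [MulAction G X]
  [MeasurableSpace Y] [MulAction G Y]
  {μ : Measure X} {ν : Measure Y}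

/-! Both invariants are spectral. `invariantS` consists of the `w` for which the character
`exp(2πi⟨w, p(g)⟩)` is an eigenvalue of the whole action (`mem_invariantS_iff`), and `invariantXi`
of the eigenvalues of the flow of the center (`mem_invariantXi_iff`). Hence they depend only on the
isomorphism class of the odometer, not on the sequence. Conjugation changes neither the projection
nor the center of a lattice, so f-isomorphic odometers have equal invariants.

Conversely, a lattice is determined up to conjugacy by its projection and its center
(`IsLattice.exists_conj_eq`). Equality of the invariants says that the projections of the two
sequences are mutually cofinal, and so are the centers. One can thus pass to indices `a n` along
which projections and centers interlace, and build two sequences with equal projections and centers: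
shrink a `Γ`-lattice to the part over a smaller `Γ'`-projection, and enlarge a `Γ'`-lattice by a
larger `Γ`-center. Each new sequence is sandwiched in the old one, so it defines the same odometer
(`exists_isAssociatedWith_of_interlaced`). -/

theorem MeasureIsomorphic.symm [MeasurableConstSMul G X] [MeasurableConstSMul G Y]
    [SMulInvariantMeasure G X μ] [SMulInvariantMeasure G Y ν]
    (h : MeasureIsomorphic G μ ν) : MeasureIsomorphic G ν μ := by
  obtain ⟨φ, ψ, hφ, hψ, hψφ, hφψ, heq⟩ := h
  refine ⟨ψ, φ, hψ, hφ, hφψ, hψφ, fun g => ?_⟩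
  have h2 := hψ.quasiMeasurePreserving.ae (heq g)
  -- `ψ ∘ φ` must be the identity at `g • ψ y`, not only at `ψ y`; invariance of `μ` keeps the
  -- exceptional set null.
  have h3 := hψ.quasiMeasurePreserving.ae
    ((measurePreserving_smul g μ).quasiMeasurePreserving.ae hψφ)
  filter_upwards [hφψ, h2, h3] with y h1 h2 h3
  rw [h1] at h2
  rw [← h2, h3]

/-- The action has a measurable eigenfunction of modulus one, for the elements of `H` and the
multiplier `χ`. -/
def HasEigenfunction (μ : Measure X) (H : Set G) (χ : G → ℂ) : Prop :=
  ∃ f : X → ℂ, Measurable f ∧ (∀ x, ‖f x‖ = 1) ∧ ∀ g ∈ H, ∀ᵐ x ∂μ, f (g • x) = χ g * f x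

theorem HasEigenfunction.of_measureIsomorphic {H : Set G} {χ : G → ℂ}
    (hν : HasEigenfunction ν H χ) (h : MeasureIsomorphic G μ ν) : HasEigenfunction μ H χ := by
  obtain ⟨φ, ψ, hφ, -, -, -, heq⟩ := h
  obtain ⟨f, hf, hf1, hfg⟩ := hν
  refine ⟨f ∘ φ, hf.comp hφ.measurable, fun x => hf1 _, fun g hg => ?_⟩
  filter_upwards [heq g, hφ.quasiMeasurePreserving.ae (hfg g hg)] with x h1 h2
  simp only [Function.comp_apply, h1, h2]

end Isomorphism

/-! ### Inverse limits, cylinder sets and interlaced sequences -/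

section GeneralOdometers

variable {G : Type*} [Group G]

theorem quotientMapOfLE_comp_apply {s t u : Subgroup G} (h : s ≤ t) (h' : t ≤ u) (q : G ⧸ s) :
    Subgroup.quotientMapOfLE h' (Subgroup.quotientMapOfLE h q) =
      Subgroup.quotientMapOfLE (h.trans h') q := by
  induction q using QuotientGroup.induction_on
  rfl

theorem quotientMapOfLE_refl_apply {s : Subgroup G} (h : s ≤ s) (q : G ⧸ s) :
    Subgroup.quotientMapOfLE h q = q := by
  induction q using QuotientGroup.induction_on
  rfl

variable [MeasurableSpace G]

theorem measurable_quotientMapOfLE {s t : Subgroup G} (h : s ≤ t) :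
    Measurable (Subgroup.quotientMapOfLE h) :=
  QuotientGroup.measurable_from_quotient.2 QuotientGroup.measurable_coe

instance quotientMeasurableConstSMul [MeasurableMul G] (s : Subgroup G) :
    MeasurableConstSMul G (G ⧸ s) where
  measurable_const_smul g := QuotientGroup.measurable_from_quotient.2 <|
    QuotientGroup.measurable_coe.comp (measurable_const_mul g)

variable [TopologicalSpace G]

namespace LatticeSeq

theorem antitone (Γ : LatticeSeq G) : Antitone Γ.lat := antitone_nat_of_succ_le Γ.nested

end LatticeSeq

/-- Discreteness is inherited from the larger group, and the invariant probability is pushed forward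
from the quotient by the smaller one. -/
theorem IsLattice.of_le_of_le [MeasurableMul G] {s t u : Subgroup G} (hs : IsLattice s) (hu : IsLattice u)
    (hst : s ≤ t) (htu : t ≤ u) : IsLattice t := by
  refine ⟨?_, ?_⟩
  · have := hu.1
    exact DiscreteTopology.of_subset (s := (u : Set G)) this htu
  · obtain ⟨ν, hν, hinv⟩ := hs.2
    refine ⟨ν.map (Subgroup.quotientMapOfLE hst),
      Measure.isProbabilityMeasure_map (measurable_quotientMapOfLE hst).aemeasurable, ⟨?_⟩⟩
    intro g A hA
    rw [Measure.map_apply (measurable_quotientMapOfLE hst) (hA.preimage (measurable_const_smul g)),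
      Measure.map_apply (measurable_quotientMapOfLE hst) hA,
      ← measure_preimage_smul_of_nullMeasurableSet
        (measurable_quotientMapOfLE hst hA).nullMeasurableSet g]
    congr 1
    ext x
    simp [quotientMapOfLE_smul]

namespace OdometerSpace

variable {Γ : LatticeSeq G}

/-- The projection of the odometer to level `n`. -/
def coord (x : OdometerSpace Γ) (n : ℕ) : G ⧸ Γ.lat n := x.1 n

theorem coord_nested (x : OdometerSpace Γ) (n : ℕ) :
    Subgroup.quotientMapOfLE (Γ.nested n) (x.coord (n + 1)) = x.coord n := x.2 n

theorem ext_coord {x y : OdometerSpace Γ} (h : ∀ n, x.coord n = y.coord n) : x = y :=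
  Subtype.ext (funext h)

theorem quotientMapOfLE_coord (x : OdometerSpace Γ) {m n : ℕ} (h : m ≤ n) :
    Subgroup.quotientMapOfLE (Γ.antitone h) (x.coord n) = x.coord m := by
  induction n, h using Nat.le_induction with
  | base => exact quotientMapOfLE_refl_apply _ _
  | succ n h ih =>
    rw [← ih, ← x.coord_nested n, quotientMapOfLE_comp_apply]

theorem measurable_coord (n : ℕ) : Measurable fun x : OdometerSpace Γ => x.coord n :=
  (measurable_pi_apply n).comp measurable_subtype_coe

theorem measurable_of_coord {α : Type*} [MeasurableSpace α] {f : α → OdometerSpace Γ}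
    (h : ∀ n, Measurable fun a => (f a).coord n) : Measurable f :=
  Measurable.subtype_mk (measurable_pi_lambda _ h)

@[simp] theorem smul_coord (g : G) (x : OdometerSpace Γ) (n : ℕ) : (g • x).coord n = g • x.coord n := rfl

instance [MeasurableMul G] : MeasurableConstSMul G (OdometerSpace Γ) where
  measurable_const_smul g :=
    measurable_of_coord fun n => (measurable_coord n).const_smul g

theorem generateFrom_coord :
    (inferInstance : MeasurableSpace (OdometerSpace Γ)) = MeasurableSpace.generateFrom
      (⋃ n, {B | MeasurableSet[MeasurableSpace.comap (fun x : OdometerSpace Γ => x.coord n)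
        inferInstance] B}) := by
  refine Eq.trans ?_ (MeasurableSpace.generateFrom_iUnion_measurableSet _).symm
  change MeasurableSpace.comap _ (⨆ n, _) = _
  rw [MeasurableSpace.comap_iSup]
  simp only [MeasurableSpace.comap_comp]
  rfl

/-- A cylinder set of level `n` is also one of level `n + 1`, so the σ-algebras of the levels
increase. -/
theorem isPiSystem_coord : IsPiSystem
    (⋃ n, {B | MeasurableSet[MeasurableSpace.comap (fun x : OdometerSpace Γ => x.coord n)
        inferInstance] B}) := by
  refine isPiSystem_iUnion_of_monotone _
    (fun n => @MeasurableSpace.isPiSystem_measurableSet _ (_)) ?_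
  refine monotone_nat_of_le_succ fun n => ?_
  rintro _ ⟨A, hA, rfl⟩
  refine ⟨_, measurable_quotientMapOfLE (Γ.nested n) hA, ?_⟩
  ext x
  simp [x.coord_nested n]

/-- An integrable function on the odometer that does not vanish almost everywhere
has nonzero integral over some cylinder set. -/
theorem exists_setIntegral_ne_zero {μ : Measure (OdometerSpace Γ)} [IsFiniteMeasure μ]
    {f : OdometerSpace Γ → ℂ} (hf : Integrable f μ) (h0 : ¬ f =ᵐ[μ] 0) :
    ∃ (n : ℕ) (A : Set (G ⧸ Γ.lat n)), MeasurableSet A ∧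
      ∫ x in (fun x : OdometerSpace Γ => x.coord n) ⁻¹' A, f x ∂μ ≠ 0 := by
  by_contra! hcon
  refine h0 (hf.ae_eq_zero_of_forall_setIntegral_eq_zero fun B hB _ => ?_)
  induction B, hB using MeasurableSpace.induction_on_inter generateFrom_coord isPiSystem_coord with
  | empty => simp
  | basic B hB =>
    obtain ⟨n, A, hA, rfl⟩ := Set.mem_iUnion.1 hB
    exact hcon n A hA
  | compl B hB ih =>
    have h1 := integral_add_compl hB hf
    -- The whole space is a cylinder set, so the total integral vanishes as well.
    have h2 := hcon 0 Set.univ MeasurableSet.univ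
    rw [Set.preimage_univ, Measure.restrict_univ] at h2
    rw [ih (measure_lt_top _ _), h2, zero_add] at h1
    exact h1
  | iUnion B hd hB ih =>
    rw [integral_iUnion hB hd hf.integrableOn]
    simp [fun i => ih i (measure_lt_top _ _)]

end OdometerSpace

/-- A function on level `n` integrated against an eigenfunction transforms by the multiplier. -/
theorem eigenfunction_integral_smul [MeasurableMul G] {Γ : LatticeSeq G}
    {μ : Measure (OdometerSpace Γ)} [SMulInvariantMeasure G (OdometerSpace Γ) μ]
    {f : OdometerSpace Γ → ℂ} {g : G} {a : ℂ} (hf : ∀ᵐ x ∂μ, f (g • x) = a * f x)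
    (n : ℕ) (F : G ⧸ Γ.lat n → ℂ) :
    a * ∫ x, F (g • x.coord n) * f x ∂μ = ∫ x, F (x.coord n) * f x ∂μ := by
  rw [← integral_const_mul, ← (measurePreserving_smul g μ).integral_comp
    (measurableEmbedding_const_smul g) fun x => F (x.coord n) * f x]
  refine integral_congr_ae ?_
  filter_upwards [hf] with x hx
  rw [hx, OdometerSpace.smul_coord]
  ring

/-- The odometer of a sequence is also the odometer of every sequence interlaced with it. -/
theorem exists_isAssociatedWith_of_interlaced [MeasurableMul G] {Γ : LatticeSeq G}
    {μ : Measure (OdometerSpace Γ)} (hμ : IsOdometerMeasure Γ μ) (s : ℕ → Subgroup G)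
    (b : ℕ → ℕ) (hb : ∀ n, n ≤ b n) (hs : ∀ n, s n ≤ Γ.lat (b n))
    (hs' : ∀ n, Γ.lat (b (n + 1)) ≤ s n) :
    ∃ Δ : LatticeSeq G, Δ.lat = s ∧ IsAssociatedWith μ Δ := by
  have := hμ.1
  have := hμ.2
  let Δ : LatticeSeq G :=
    { lat := s
      isLattice := fun n => (Γ.isLattice _).of_le_of_le (Γ.isLattice _) (hs' n) (hs n)
      nested := fun n => (hs (n + 1)).trans (hs' n) }
  have hsn (n : ℕ) : s n ≤ Γ.lat n := (hs n).trans (Γ.antitone (hb n))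
  -- Level `b (n + 1)` is used because its lattice lies inside `s n`. As `b` need not be monotone,
  -- compatibility is checked from the larger of two consecutive levels.
  let φ : OdometerSpace Γ → OdometerSpace Δ := fun x =>
    ⟨fun n => Subgroup.quotientMapOfLE (hs' n) (x.coord (b (n + 1))), fun n => by
      change Subgroup.quotientMapOfLE _ (Subgroup.quotientMapOfLE _ _) =
        Subgroup.quotientMapOfLE _ _
      rw [← x.quotientMapOfLE_coord (le_max_left (b (n + 1 + 1)) (b (n + 1))),
        ← x.quotientMapOfLE_coord (le_max_right (b (n + 1 + 1)) (b (n + 1)))]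
      simp only [quotientMapOfLE_comp_apply]⟩
  let ψ : OdometerSpace Δ → OdometerSpace Γ := fun y =>
    ⟨fun n => Subgroup.quotientMapOfLE (hsn n) (y.coord n), fun n => by
      change Subgroup.quotientMapOfLE _ (Subgroup.quotientMapOfLE _ _) =
        Subgroup.quotientMapOfLE _ _
      rw [← y.coord_nested n]
      simp only [quotientMapOfLE_comp_apply]⟩
  have hφ : Measurable φ := OdometerSpace.measurable_of_coord fun n =>
    (measurable_quotientMapOfLE (hs' n)).comp (OdometerSpace.measurable_coord _)
  have hψ : Measurable ψ := OdometerSpace.measurable_of_coord fun n =>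
    (measurable_quotientMapOfLE (hsn n)).comp (OdometerSpace.measurable_coord _)
  have hψφ (x) : ψ (φ x) = x := by
    refine OdometerSpace.ext_coord fun n => ?_
    change Subgroup.quotientMapOfLE (hsn n) (Subgroup.quotientMapOfLE (hs' n) _) = _
    rw [quotientMapOfLE_comp_apply]
    exact x.quotientMapOfLE_coord (n.le_succ.trans (hb _))
  have hφψ (y) : φ (ψ y) = y := by
    refine OdometerSpace.ext_coord fun n => ?_
    change Subgroup.quotientMapOfLE (hs' n) (Subgroup.quotientMapOfLE (hsn _) _) = _
    rw [quotientMapOfLE_comp_apply]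
    exact y.quotientMapOfLE_coord (n.le_succ.trans (hb _))
  have heq (g : G) (x) : φ (g • x) = g • φ x :=
    OdometerSpace.ext_coord fun n => quotientMapOfLE_smul (hs' n) g (x.coord (b (n + 1)))
  refine ⟨Δ, rfl, μ.map φ, ⟨Measure.isProbabilityMeasure_map hφ.aemeasurable, ⟨?_⟩⟩, φ, ψ,
    ⟨hφ, rfl⟩, ⟨hψ, ?_⟩, .of_forall hψφ, .of_forall hφψ, fun g => .of_forall (heq g)⟩
  · intro g A hA
    rw [Measure.map_apply hφ (hA.preimage (measurable_const_smul g)), Measure.map_apply hφ hA,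
      ← measure_preimage_smul_of_nullMeasurableSet (hφ hA).nullMeasurableSet g]
    congr 1
    ext x
    simp [heq]
  · rw [Measure.map_map hψ hφ]
    convert Measure.map_id
    exact funext hψφ

end GeneralOdometers

/-! ### Coordinates and measurability in the Heisenberg group -/

namespace Heis

@[simp] theorem mul_x (g h : Heis) : (g * h).x = g.x + h.x := rfl
@[simp] theorem mul_y (g h : Heis) : (g * h).y = g.y + h.y := rfl
@[simp] theorem mul_z (g h : Heis) : (g * h).z = g.z + h.z + g.x * h.y := rfl
@[simp] theorem one_x : (1 : Heis).x = 0 := rfl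
@[simp] theorem one_y : (1 : Heis).y = 0 := rfl
@[simp] theorem one_z : (1 : Heis).z = 0 := rfl
@[simp] theorem inv_x (g : Heis) : (g⁻¹).x = -g.x := rfl
@[simp] theorem inv_y (g : Heis) : (g⁻¹).y = -g.y := rfl
@[simp] theorem inv_z (g : Heis) : (g⁻¹).z = -g.z + g.x * g.y := rfl
@[simp] theorem c_x (t : ℝ) : (c t).x = 0 := rfl
@[simp] theorem c_y (t : ℝ) : (c t).y = 0 := rfl
@[simp] theorem c_z (t : ℝ) : (c t).z = t := rfl
@[simp] theorem p_fst (g : Heis) : (p g).1 = g.x := rfl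
@[simp] theorem p_snd (g : Heis) : (p g).2 = g.y := rfl

@[simp] theorem zpow_x (g : Heis) (n : ℤ) : (g ^ n).x = n * g.x := by
  let f : Heis →* Multiplicative ℝ :=
    { toFun := fun g => Multiplicative.ofAdd g.x, map_one' := rfl, map_mul' := fun _ _ => rfl }
  have h : Multiplicative.toAdd (f (g ^ n)) = n • g.x := by rw [map_zpow]; rfl
  rw [zsmul_eq_mul] at h
  exact h

@[simp] theorem zpow_y (g : Heis) (n : ℤ) : (g ^ n).y = n * g.y := by
  let f : Heis →* Multiplicative ℝ :=
    { toFun := fun g => Multiplicative.ofAdd g.y, map_one' := rfl, map_mul' := fun _ _ => rfl }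
  have h : Multiplicative.toAdd (f (g ^ n)) = n • g.y := by rw [map_zpow]; rfl
  rw [zsmul_eq_mul] at h
  exact h

theorem c_add (s t : ℝ) : c (s + t) = c s * c t := by ext <;> simp

theorem c_neg (t : ℝ) : c (-t) = (c t)⁻¹ := by ext <;> simp

theorem c_zero : c 0 = 1 := rfl

theorem c_comm (t : ℝ) (g : Heis) : c t * g = g * c t := by ext <;> simp [add_comm]

theorem eq_c_of_p_eq_zero {g : Heis} (hx : g.x = 0) (hy : g.y = 0) : g = c g.z := by
  ext <;> simp [hx, hy]

/-- Commutators see only the projections, through the area form. This makes the area form integral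
on the projection of a lattice, and central averages invariant under the lattice. -/
theorem commutator_eq (g h : Heis) : g * h * g⁻¹ * h⁻¹ = c (g.x * h.y - h.x * g.y) := by
  ext <;> simp
  ring

theorem continuous_c : Continuous c :=
  continuous_induced_rng.2 (continuous_const.prodMk (continuous_const.prodMk continuous_id))

theorem continuous_coords : Continuous fun g : Heis => (g.x, g.y, g.z) := continuous_induced_dom

theorem measurable_x : Measurable fun g : Heis => g.x :=
  (continuous_fst.comp continuous_coords).measurable

theorem measurable_y : Measurable fun g : Heis => g.y :=
  (continuous_fst.comp (continuous_snd.comp continuous_coords)).measurable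

theorem measurable_z : Measurable fun g : Heis => g.z :=
  (continuous_snd.comp (continuous_snd.comp continuous_coords)).measurable

theorem measurable_of_coords {α : Type*} [MeasurableSpace α] {f : α → Heis}
    (hx : Measurable fun a => (f a).x) (hy : Measurable fun a => (f a).y)
    (hz : Measurable fun a => (f a).z) : Measurable f := by
  have h : Measurable fun a => ((f a).x, (f a).y, (f a).z) := hx.prodMk (hy.prodMk hz)
  intro A hA
  change MeasurableSet[borel Heis] A at hA
  rw [show borel Heis = MeasurableSpace.comap (fun g : Heis => (g.x, g.y, g.z)) (borel _) from
    borel_comap] at hA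
  obtain ⟨B, hB, rfl⟩ := hA
  rw [← BorelSpace.measurable_eq] at hB
  exact h hB

instance : MeasurableMul₂ Heis where
  measurable_mul := measurable_of_coords
    ((measurable_x.comp measurable_fst).add (measurable_x.comp measurable_snd))
    ((measurable_y.comp measurable_fst).add (measurable_y.comp measurable_snd))
    (((measurable_z.comp measurable_fst).add (measurable_z.comp measurable_snd)).add
      ((measurable_x.comp measurable_fst).mul (measurable_y.comp measurable_snd)))

end Heis

/-! ### Bases of lattices and measurable sections -/

open Heis

/-- `g₁` and `g₂` project to a basis of `p(Λ)`, and `c(r)` generates the center of `Λ`. -/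
structure IsHeisBasis (Λ : Subgroup Heis) (g₁ g₂ : Heis) (r : ℝ) : Prop where
  mem₁ : g₁ ∈ Λ
  mem₂ : g₂ ∈ Λ
  det_ne : g₁.x * g₂.y - g₂.x * g₁.y ≠ 0
  pos : 0 < r
  center : ∀ t : ℝ, c t ∈ Λ ↔ ∃ m : ℤ, t = m * r
  span : ∀ γ ∈ Λ, ∃ n m : ℤ, γ.x = n * g₁.x + m * g₂.x ∧ γ.y = n * g₁.y + m * g₂.y

theorem IsHeisBasis.centralGenerator {Λ : Subgroup Heis} {g₁ g₂ : Heis} {r : ℝ}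
    (h : IsHeisBasis Λ g₁ g₂ r) : centralGenerator Λ = r :=
  centralGenerator_eq h.pos h.center

/-- A translation invariant measure on the line is not a probability measure. -/
theorem not_isProbabilityMeasure_of_isAddLeftInvariant (ρ : Measure ℝ) [ρ.IsAddLeftInvariant] :
    ¬ IsProbabilityMeasure ρ := by
  intro h
  have : ρ.IsOpenPosMeasure :=
    isOpenPosMeasure_of_addLeftInvariant_of_regular
  have h1 := measure_univ_of_isAddLeftInvariant ρ
  simp at h1

/-- The projection of a lattice to the plane is not contained in a line. -/
theorem IsLattice.exists_linear_ne_zero {Λ : Subgroup Heis} (hΛ : IsLattice Λ) (a b : ℝ)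
    (hab : a ≠ 0 ∨ b ≠ 0) : ∃ γ ∈ Λ, a * γ.x + b * γ.y ≠ 0 := by
  by_contra! hcon
  obtain ⟨ν, hν, hinv⟩ := hΛ.2
  -- A linear form vanishing on `Λ` descends to the quotient and would push `ν` to a translation
  -- invariant probability on the line.
  let l : Heis ⧸ Λ → ℝ := Quotient.lift (fun g : Heis => a * g.x + b * g.y) (by
    intro g h hgh
    have := hcon _ (QuotientGroup.leftRel_apply.1 hgh)
    simp at this
    linarith)
  have hl : Measurable l := QuotientGroup.measurable_from_quotient.2
    ((measurable_x.const_mul a).add (measurable_y.const_mul b))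
  have hsmul (g : Heis) (q : Heis ⧸ Λ) : l (g • q) = (a * g.x + b * g.y) + l q := by
    induction q using QuotientGroup.induction_on with | H h => ?_
    change a * (g * h).x + b * (g * h).y = _ + (a * h.x + b * h.y)
    simp only [mul_x, mul_y]
    ring
  have hsurj (t : ℝ) : ∃ g : Heis, a * g.x + b * g.y = t := by
    rcases hab with h | h
    · exact ⟨⟨t / a, 0, 0⟩, by simp; field_simp⟩
    · exact ⟨⟨0, t / b, 0⟩, by simp; field_simp⟩
  have : (ν.map l).IsAddLeftInvariant := by
    refine ⟨fun t => ?_⟩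
    obtain ⟨g, hg⟩ := hsurj t
    rw [Measure.map_map (measurable_const_add t) hl]
    conv_rhs => rw [← (measurePreserving_smul g ν).map_eq,
      Measure.map_map hl (measurable_const_smul g)]
    congr 1
    ext q
    simp [hsmul, hg]
  exact not_isProbabilityMeasure_of_isAddLeftInvariant (ν.map l)
    (Measure.isProbabilityMeasure_map hl.aemeasurable)

/-- The center of a discrete subgroup containing a nontrivial central element is infinite cyclic. -/
theorem exists_center_generator {Λ : Subgroup Heis} (hΛ : DiscreteTopology Λ) {d : ℝ} (hd : d ≠ 0)
    (hdΛ : c d ∈ Λ) : ∃ r : ℝ, 0 < r ∧ ∀ t : ℝ, c t ∈ Λ ↔ ∃ m : ℤ, t = m * r := by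
  let Z : AddSubgroup ℝ :=
    { carrier := {t | c t ∈ Λ}
      zero_mem' := Λ.one_mem
      add_mem' := fun {s t} hs ht => by
        simp only [Set.mem_ofPred_eq, c_add] at *
        exact Λ.mul_mem hs ht
      neg_mem' := fun {t} ht => by
        simp only [Set.mem_ofPred_eq, c_neg] at *
        exact Λ.inv_mem ht }
  have hiso : ∃ a, 0 < a ∧ Disjoint (Z : Set ℝ) (Set.Ioo 0 a) := by
    obtain ⟨U, hU, hUΛ⟩ := (discreteTopology_subtype_iff'.1 hΛ) 1 Λ.one_mem
    have h1 : (1 : Heis) ∈ U := by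
      have : (1 : Heis) ∈ U ∩ (Λ : Set Heis) := by rw [hUΛ]; rfl
      exact this.1
    obtain ⟨ε, hε, hball⟩ := Metric.isOpen_iff.1 (hU.preimage continuous_c) 0 h1
    refine ⟨ε, hε, Set.disjoint_left.2 fun t ht htε => ?_⟩
    have h2 : c t ∈ U ∩ (Λ : Set Heis) :=
      ⟨hball (by simpa [abs_of_pos htε.1] using htε.2), ht⟩
    rw [hUΛ] at h2
    have : t = 0 := congrArg Heis.z (show c t = 1 from h2)
    exact htε.1.ne' this
  obtain ⟨b, hb⟩ := AddSubgroup.cyclic_of_isolated_zero hiso.choose_spec.1 hiso.choose_spec.2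
  have hmem (t : ℝ) : c t ∈ Λ ↔ ∃ m : ℤ, m * b = t := by
    change t ∈ Z ↔ _
    rw [hb, AddSubgroup.mem_closure_singleton]
    simp
  have hb0 : b ≠ 0 := by
    rintro rfl
    obtain ⟨m, hm⟩ := (hmem d).1 hdΛ
    exact hd (by simpa using hm.symm)
  refine ⟨|b|, abs_pos.2 hb0, fun t => (hmem t).trans ?_⟩
  rcases abs_choice b with h | h <;> rw [h]
  · simp only [eq_comm]
  · constructor
    · rintro ⟨m, rfl⟩
      exact ⟨-m, by simp⟩
    · rintro ⟨m, rfl⟩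
      exact ⟨-m, by simp⟩

/-- The area form takes values in `ℤ r` on the projection, since commutators lie in the center of
`Λ`. A basis then comes from a triangular reduction over `ℤ`: `A₁` holds the pairings with `γ₁`, and
`A₂` the pairings with `γ₂` on the kernel of the first pairing. Elements `g₂` and `g₁` realizing
their generators span. -/
theorem IsLattice.exists_isHeisBasis {Λ : Subgroup Heis} (hΛ : IsLattice Λ) :
    ∃ g₁ g₂, IsHeisBasis Λ g₁ g₂ (centralGenerator Λ) := by
  suffices ∃ g₁ g₂ r, IsHeisBasis Λ g₁ g₂ r by
    obtain ⟨g₁, g₂, r, h⟩ := this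
    exact ⟨g₁, g₂, by rwa [h.centralGenerator]⟩
  obtain ⟨γ₁, h₁, hγ₁⟩ := hΛ.exists_linear_ne_zero 1 0 (by simp)
  simp only [one_mul, zero_mul, add_zero] at hγ₁
  obtain ⟨γ₂, h₂, hD⟩ := hΛ.exists_linear_ne_zero (-γ₁.y) γ₁.x (.inr hγ₁)
  have hcomm {g h : Heis} (hg : g ∈ Λ) (hh : h ∈ Λ) : c (g.x * h.y - h.x * g.y) ∈ Λ := by
    rw [← commutator_eq]
    exact Λ.mul_mem (Λ.mul_mem (Λ.mul_mem hg hh) (Λ.inv_mem hg)) (Λ.inv_mem hh)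
  obtain ⟨r, hr, hcen⟩ := exists_center_generator hΛ.1
    (d := γ₁.x * γ₂.y - γ₂.x * γ₁.y) (by intro h; apply hD; linarith) (hcomm h₁ h₂)
  have hint {g h : Heis} (hg : g ∈ Λ) (hh : h ∈ Λ) :
      ∃ m : ℤ, g.x * h.y - h.x * g.y = m * r := (hcen _).1 (hcomm hg hh)
  let A₁ : AddSubgroup ℤ :=
    { carrier := {n | ∃ γ ∈ Λ, γ.x * γ₁.y - γ₁.x * γ.y = n * r}
      zero_mem' := ⟨1, Λ.one_mem, by simp⟩
      add_mem' := by
        rintro n m ⟨g, hg, hg'⟩ ⟨h, hh, hh'⟩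
        refine ⟨g * h, Λ.mul_mem hg hh, ?_⟩
        push_cast
        simp only [mul_x, mul_y]
        linear_combination hg' + hh'
      neg_mem' := by
        rintro n ⟨g, hg, hg'⟩
        refine ⟨g⁻¹, Λ.inv_mem hg, ?_⟩
        push_cast
        simp only [inv_x, inv_y]
        linear_combination -hg' }
  let A₂ : AddSubgroup ℤ :=
    { carrier := {n | ∃ γ ∈ Λ, γ.x * γ₁.y - γ₁.x * γ.y = 0 ∧ γ.x * γ₂.y - γ₂.x * γ.y = n * r}
      zero_mem' := ⟨1, Λ.one_mem, by simp⟩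
      add_mem' := by
        rintro n m ⟨g, hg, hg0, hg'⟩ ⟨h, hh, hh0, hh'⟩
        refine ⟨g * h, Λ.mul_mem hg hh, ?_, ?_⟩
        · simp only [mul_x, mul_y]
          linear_combination hg0 + hh0
        · push_cast
          simp only [mul_x, mul_y]
          linear_combination hg' + hh'
      neg_mem' := by
        rintro n ⟨g, hg, hg0, hg'⟩
        refine ⟨g⁻¹, Λ.inv_mem hg, ?_, ?_⟩
        · simp only [inv_x, inv_y]
          linear_combination -hg0
        · push_cast
          simp only [inv_x, inv_y]
          linear_combination -hg' }
  obtain ⟨d, hd⟩ := Int.subgroup_cyclic A₁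
  obtain ⟨e, he⟩ := Int.subgroup_cyclic A₂
  rw [← AddSubgroup.zmultiples_eq_closure] at hd he
  obtain ⟨g₂, hg₂, hg₂d⟩ : d ∈ A₁ := hd ▸ AddSubgroup.mem_zmultiples d
  obtain ⟨g₁, hg₁, hg₁0, hg₁e⟩ : e ∈ A₂ := he ▸ AddSubgroup.mem_zmultiples e
  have hspan : ∀ γ ∈ Λ, ∃ n m : ℤ, γ.x = n * g₁.x + m * g₂.x ∧ γ.y = n * g₁.y + m * g₂.y := by
    intro γ hγ
    obtain ⟨k, hk⟩ := hint hγ h₁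
    have hkA : k ∈ A₁ := ⟨γ, hγ, hk⟩
    rw [hd] at hkA
    obtain ⟨m, rfl⟩ := AddSubgroup.mem_zmultiples_iff.1 hkA
    -- Removing `m` copies of `g₂` moves `γ` into the kernel of the pairing with `γ₁`.
    have hγ' : γ * g₂ ^ (-m) ∈ Λ := Λ.mul_mem hγ (Λ.zpow_mem hg₂ _)
    obtain ⟨l, hl⟩ := hint hγ' h₂
    have hl0 : (γ * g₂ ^ (-m)).x * γ₁.y - γ₁.x * (γ * g₂ ^ (-m)).y = 0 := by
      simp at hk ⊢
      linear_combination hk - m * hg₂d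
    have hlA : l ∈ A₂ := ⟨_, hγ', hl0, hl⟩
    rw [he] at hlA
    obtain ⟨n, rfl⟩ := AddSubgroup.mem_zmultiples_iff.1 hlA
    refine ⟨n, m, ?_, ?_⟩
    -- A plane vector is determined by its pairings with the independent vectors `p γ₁` and `p γ₂`
    -- (Cramer).
    all_goals
      simp at hl hl0
      refine mul_left_cancel₀ hD ?_
    · linear_combination γ₁.x * hl - n * γ₁.x * hg₁e - γ₂.x * hl0 + n * γ₂.x * hg₁0
    · linear_combination γ₁.y * hl - n * γ₁.y * hg₁e - γ₂.y * hl0 + n * γ₂.y * hg₁0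
  refine ⟨g₁, g₂, r, hg₁, hg₂, ?_, hr, hcen, hspan⟩
  obtain ⟨n₁, m₁, hx₁, hy₁⟩ := hspan γ₁ h₁
  obtain ⟨n₂, m₂, hx₂, hy₂⟩ := hspan γ₂ h₂
  intro h0
  apply hD
  rw [hx₁, hy₁, hx₂, hy₂]
  linear_combination (n₁ * m₂ - m₁ * n₂ : ℝ) * h0

/-- A measurable reduction of the Heisenberg group modulo a lattice, up to the center of the
lattice, which commutes with the center of the group. -/
theorem IsHeisBasis.exists_measurable_reduction {Λ : Subgroup Heis} {g₁ g₂ : Heis} {r : ℝ}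
    (h : IsHeisBasis Λ g₁ g₂ r) :
    ∃ ρ : Heis → Heis, Measurable ρ ∧ (∀ g, g⁻¹ * ρ g ∈ Λ) ∧
      (∀ g, ∀ γ ∈ Λ, ∃ k : ℤ, ρ (g * γ) = ρ g * c (k * r)) ∧ ∀ t g, ρ (c t * g) = c t * ρ g := by
  set D := g₁.x * g₂.y - g₂.x * g₁.y with hD
  have hD0 : D ≠ 0 := h.det_ne
  -- Integer parts of the coordinates of `p g` in the basis `p g₁`, `p g₂`; `ρ` brings the
  -- projection into the fundamental parallelogram.
  let a : Heis → ℤ := fun g => ⌊(g.x * g₂.y - g₂.x * g.y) / D⌋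
  let b : Heis → ℤ := fun g => ⌊(g₁.x * g.y - g.x * g₁.y) / D⌋
  have ha : Measurable a := Int.measurable_floor.comp
    (((measurable_x.mul_const _).sub (measurable_y.const_mul _)).div_const _)
  have hb : Measurable b := Int.measurable_floor.comp
    (((measurable_y.const_mul _).sub (measurable_x.mul_const _)).div_const _)
  let ρ : Heis → Heis := fun g => g * (g₁ ^ (-a g) * g₂ ^ (-b g))
  have hmem (g : Heis) : g⁻¹ * ρ g ∈ Λ := by
    simp only [ρ, inv_mul_cancel_left]
    exact Λ.mul_mem (Λ.zpow_mem h.mem₁ _) (Λ.zpow_mem h.mem₂ _)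
  refine ⟨ρ, ?_, hmem, ?_, ?_⟩
  · refine measurable_id.mul (Measurable.mul ?_ ?_)
    · exact (Measurable.of_discrete (f := fun n : ℤ => g₁ ^ (-n))).comp ha
    · exact (Measurable.of_discrete (f := fun n : ℤ => g₂ ^ (-n))).comp hb
  · intro g γ hγ
    obtain ⟨n, m, hx, hy⟩ := h.span γ hγ
    have ha' : a (g * γ) = a g + n := by
      simp only [a]
      rw [← Int.floor_add_intCast]
      congr 1
      simp only [mul_x, mul_y, hx, hy]
      field_simp
      rw [hD]
      ring
    have hb' : b (g * γ) = b g + m := by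
      simp only [b]
      rw [← Int.floor_add_intCast]
      congr 1
      simp only [mul_x, mul_y, hx, hy]
      field_simp
      rw [hD]
      ring
    have hΛ : (ρ g)⁻¹ * ρ (g * γ) ∈ Λ := by
      have := Λ.mul_mem (Λ.mul_mem (Λ.inv_mem (hmem g)) hγ) (hmem (g * γ))
      simpa [mul_assoc] using this
    have hc := eq_c_of_p_eq_zero (g := (ρ g)⁻¹ * ρ (g * γ))
      (by simp [ρ, ha', hb', hx]; ring) (by simp [ρ, ha', hb', hy]; ring)
    rw [hc] at hΛ
    obtain ⟨k, hk⟩ := (h.center _).1 hΛ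
    exact ⟨k, by rw [← hk, ← hc, mul_inv_cancel_left]⟩
  · intro t g
    have ha' : a (c t * g) = a g := by simp [a]
    have hb' : b (c t * g) = b g := by simp [b]
    simp only [ρ, ha', hb', mul_assoc]

/-- The projection to a homogeneous space of a lattice has a measurable section. -/
theorem IsHeisBasis.exists_measurable_section {Λ : Subgroup Heis} {g₁ g₂ : Heis} {r : ℝ}
    (h : IsHeisBasis Λ g₁ g₂ r) :
    ∃ s : Heis ⧸ Λ → Heis, Measurable s ∧ ∀ q, (s q : Heis ⧸ Λ) = q := by
  obtain ⟨ρ, hρ, hmem, hγ, -⟩ := h.exists_measurable_reduction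
  -- The ambiguity left in `ρ` is a power of `c r`; it is removed by reducing the central coordinate
  -- to `[0, r)`.
  let σ : Heis → Heis := fun g => ρ g * c (-(⌊(ρ g).z / r⌋ * r))
  have hr := h.pos.ne'
  have hσ : ∀ g, ∀ γ ∈ Λ, σ (g * γ) = σ g := by
    intro g γ hγΛ
    obtain ⟨k, hk⟩ := hγ g γ hγΛ
    have hz : (ρ g * c (k * r)).z / r = (ρ g).z / r + k := by
      simp
      field_simp
    simp only [σ, hk, hz, Int.floor_add_intCast, mul_assoc, ← c_add]
    congr 2
    push_cast
    ring
  refine ⟨Quotient.lift σ fun g g' hgg' => ?_,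
    QuotientGroup.measurable_from_quotient.2 ?_, fun q => ?_⟩
  · rw [← hσ g _ (QuotientGroup.leftRel_apply.1 hgg'), mul_inv_cancel_left]
  · refine hρ.mul (continuous_c.measurable.comp ?_)
    exact (((Measurable.of_discrete (f := fun n : ℤ => (n : ℝ))).comp
      (Int.measurable_floor.comp ((measurable_z.comp hρ).div_const r))).mul_const r).neg
  · induction q using QuotientGroup.induction_on with | H g => ?_
    refine (QuotientGroup.eq.2 ?_).symm
    change g⁻¹ * (ρ g * c _) ∈ Λ
    rw [← mul_assoc]
    exact Λ.mul_mem (hmem g) ((h.center _).2 ⟨-⌊(ρ g).z / r⌋, by push_cast; ring⟩)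

/-- A measurable section turns the action into multiplication in the group. Joint measurability is
needed for Fubini when averaging over the center. -/
theorem IsHeisBasis.measurable_smul {Λ : Subgroup Heis} {g₁ g₂ : Heis} {r : ℝ}
    (h : IsHeisBasis Λ g₁ g₂ r) : Measurable fun q : Heis × (Heis ⧸ Λ) => q.1 • q.2 := by
  obtain ⟨s, hs, hsq⟩ := h.exists_measurable_section
  have h1 : Measurable fun q : Heis × (Heis ⧸ Λ) => ((q.1 * s q.2 : Heis) : Heis ⧸ Λ) :=
    QuotientGroup.measurable_coe.comp (measurable_fst.mul (hs.comp measurable_snd))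
  convert h1 using 2 with q
  conv_lhs => rw [← hsq q.2]
  rfl

/-- The additive character `t ↦ exp(2πit)` of the line. -/
noncomputable def unitExp (t : ℝ) : ℂ := Complex.exp ((2 * Real.pi * t : ℝ) * Complex.I)

theorem unitExp_add (s t : ℝ) : unitExp (s + t) = unitExp s * unitExp t := by
  rw [unitExp, unitExp, unitExp, ← Complex.exp_add]
  congr 1
  push_cast
  ring

theorem unitExp_zero : unitExp 0 = 1 := by simp [unitExp]

theorem norm_unitExp (t : ℝ) : ‖unitExp t‖ = 1 := Complex.norm_exp_ofReal_mul_I _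

theorem unitExp_eq_one_iff (t : ℝ) : unitExp t = 1 ↔ ∃ n : ℤ, t = n := by
  rw [unitExp, Complex.exp_eq_one_iff]
  refine exists_congr fun n => ?_
  rw [← Complex.ofReal_inj]
  have h2 : (2 * Real.pi * Complex.I : ℂ) ≠ 0 := Complex.two_pi_I_ne_zero
  constructor
  · intro h
    refine mul_left_cancel₀ h2 ?_
    push_cast at h ⊢
    linear_combination h
  · intro h
    rw [Complex.ofReal_mul, h]
    push_cast
    ring

theorem unitExp_add_int (t : ℝ) (n : ℤ) : unitExp (t + n) = unitExp t := by
  rw [unitExp_add, (unitExp_eq_one_iff n).2 ⟨n, rfl⟩, mul_one]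

theorem measurable_unitExp : Measurable unitExp := by
  unfold unitExp
  fun_prop

/-! ### The invariants as sets of eigenvalues -/

section Spectrum

variable {Γ : LatticeSeq Heis} {μ : Measure (OdometerSpace Γ)}

/-- A measurable function on the group which is periodic modulo one of the lattices defines an
eigenfunction of the odometer. -/
theorem hasEigenfunction_of_periodic (j : ℕ) {e : Heis → ℂ} (he : Measurable e)
    (he1 : ∀ g, ‖e g‖ = 1) (hper : ∀ g, ∀ γ ∈ Γ.lat j, e (g * γ) = e g) {H : Set Heis}
    {χ : Heis → ℂ} (hχ : ∀ g ∈ H, ∀ h, e (g * h) = χ g * e h) : HasEigenfunction μ H χ := by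
  let F : Heis ⧸ Γ.lat j → ℂ := Quotient.lift e fun g h hgh => by
    rw [← hper g _ (QuotientGroup.leftRel_apply.1 hgh), mul_inv_cancel_left]
  have hF : Measurable F := QuotientGroup.measurable_from_quotient.2 he
  have hF1 (q) : ‖F q‖ = 1 := by
    induction q using QuotientGroup.induction_on
    exact he1 _
  have hFg (g) (hg : g ∈ H) (q) : F (g • q) = χ g * F q := by
    induction q using QuotientGroup.induction_on
    exact hχ g hg _
  exact ⟨fun x => F (x.coord j), hF.comp (OdometerSpace.measurable_coord j), fun x => hF1 _,
    fun g hg => .of_forall fun x => hFg g hg _⟩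

theorem hasEigenfunction_of_mem_invariantS {w : ℝ × ℝ} (hw : w ∈ invariantS Γ) :
    HasEigenfunction μ Set.univ fun g : Heis => unitExp (w.1 * g.x + w.2 * g.y) := by
  obtain ⟨j, hj⟩ := Set.mem_iUnion.1 hw
  refine hasEigenfunction_of_periodic j (e := fun g => unitExp (w.1 * g.x + w.2 * g.y))
    (measurable_unitExp.comp ((measurable_x.const_mul _).add (measurable_y.const_mul _)))
    (fun g => norm_unitExp _) (fun g γ hγ => ?_) (fun g _ h => ?_)
  · obtain ⟨m, hm⟩ := hj _ ⟨γ, hγ, rfl⟩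
    rw [← unitExp_add_int (w.1 * g.x + w.2 * g.y) m, ← hm]
    congr 1
    simp
    ring
  · rw [← unitExp_add]
    congr 1
    simp
    ring

/-- The coordinate `z` does not descend to the quotient even modulo the central generator `r`, but
that of the reduction `ρ g` does, and it is shifted by `t` under `c t`. -/
theorem hasEigenfunction_of_mem_invariantXi {s : ℝ} (hs : s ∈ invariantXi Γ) :
    HasEigenfunction μ (Set.range c) fun g : Heis => unitExp (s * g.z) := by
  obtain ⟨j, m, rfl⟩ := Set.mem_iUnion.1 hs
  obtain ⟨g₁, g₂, hb⟩ := (Γ.isLattice j).exists_isHeisBasis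
  obtain ⟨ρ, hρ, -, hγ, hc⟩ := hb.exists_measurable_reduction
  set r := centralGenerator (Γ.lat j)
  have hr := hb.pos.ne'
  refine hasEigenfunction_of_periodic j (e := fun g => unitExp (r⁻¹ * m * (ρ g).z))
    (measurable_unitExp.comp ((measurable_z.comp hρ).const_mul _))
    (fun g => norm_unitExp _) (fun g γ hγΛ => ?_) ?_
  · obtain ⟨k, hk⟩ := hγ g γ hγΛ
    rw [← unitExp_add_int (r⁻¹ * m * (ρ g).z) (m * k), hk]
    congr 1
    simp
    field_simp
  · rintro _ ⟨t, rfl⟩ h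
    rw [← unitExp_add, hc]
    congr 1
    simp
    ring

/-- An eigenfunction correlates with the indicator function of some cylinder set. -/
theorem exists_integral_indicator_mul_ne_zero [IsProbabilityMeasure μ] {f : OdometerSpace Γ → ℂ}
    (hf : Measurable f) (hf1 : ∀ x, ‖f x‖ = 1) :
    ∃ (j : ℕ) (F : Heis ⧸ Γ.lat j → ℂ), Measurable F ∧ (∀ q, ‖F q‖ ≤ 1) ∧
      ∫ x, F (x.coord j) * f x ∂μ ≠ 0 := by
  have hint : Integrable f μ :=
    .of_bound hf.aestronglyMeasurable 1 (.of_forall fun x => (hf1 x).le)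
  have h0 : ¬ f =ᵐ[μ] 0 := by
    intro h
    obtain ⟨x, hx⟩ := h.exists
    have := hf1 x
    simp [hx] at this
  obtain ⟨j, A, hA, hne⟩ := OdometerSpace.exists_setIntegral_ne_zero hint h0
  refine ⟨j, A.indicator 1, measurable_one.indicator hA, fun q => ?_, ?_⟩
  · by_cases hq : q ∈ A <;> simp [hq]
  · rw [← integral_indicator (OdometerSpace.measurable_coord j hA)] at hne
    convert hne using 3 with x
    by_cases hx : x.coord j ∈ A <;> simp [hx]

/-- The eigenfunction correlates with some function of level `j`. There the generator `c r` of the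
center acts trivially, so its multiplier `unitExp (s * r)` must be 1. -/
theorem mem_invariantXi_of_hasEigenfunction (hμ : IsOdometerMeasure Γ μ) {s : ℝ}
    (h : HasEigenfunction μ (Set.range c) fun g : Heis => unitExp (s * g.z)) :
    s ∈ invariantXi Γ := by
  have := hμ.1
  have := hμ.2
  obtain ⟨f, hf, hf1, hfg⟩ := h
  obtain ⟨j, F, hF, -, hne⟩ := exists_integral_indicator_mul_ne_zero (μ := μ) hf hf1
  obtain ⟨g₁, g₂, hb⟩ := (Γ.isLattice j).exists_isHeisBasis
  set r := centralGenerator (Γ.lat j) with hr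
  have htriv (q : Heis ⧸ Γ.lat j) : c r • q = q := by
    induction q using QuotientGroup.induction_on with | H g => ?_
    refine (QuotientGroup.eq.2 ?_).symm
    change g⁻¹ * (c r * g) ∈ _
    rw [c_comm, inv_mul_cancel_left]
    exact (hb.center r).2 ⟨1, by simp⟩
  have h1 := eigenfunction_integral_smul (hfg (c r) ⟨r, rfl⟩) j F
  simp only [htriv] at h1
  obtain ⟨n, hn⟩ := (unitExp_eq_one_iff _).1 (mul_eq_right₀ hne |>.1 h1)
  refine Set.mem_iUnion.2 ⟨j, n, ?_⟩
  have hr0 := hb.pos.ne'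
  rw [← hr, ← hn]
  simp
  field_simp

/-- The multiplier is trivial on the center, so averaging the correlating function over the center
keeps the correlation. The average `Φ` is invariant under every `γ` of the lattice, which forces the
multiplier at `γ` to be 1. -/
theorem mem_invariantS_of_hasEigenfunction (hμ : IsOdometerMeasure Γ μ) {w : ℝ × ℝ}
    (h : HasEigenfunction μ Set.univ
      fun g : Heis => unitExp (w.1 * g.x + w.2 * g.y)) :
    w ∈ invariantS Γ := by
  have := hμ.1
  have := hμ.2
  obtain ⟨f, hf, hf1, hfg⟩ := h
  obtain ⟨j, F, hF, hF1, hne⟩ := exists_integral_indicator_mul_ne_zero (μ := μ) hf hf1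
  obtain ⟨g₁, g₂, hb⟩ := (Γ.isLattice j).exists_isHeisBasis
  set r := centralGenerator (Γ.lat j) with hr
  have hr0 := hb.pos
  let Φ : Heis ⧸ Γ.lat j → ℂ := fun q => ∫ t in (0 : ℝ)..r, F (c t • q)
  have hper (q : Heis ⧸ Γ.lat j) : Function.Periodic (fun t => F (c t • q)) r := by
    intro t
    induction q using QuotientGroup.induction_on with | H g => ?_
    change F ((c (t + r) * g : Heis) : Heis ⧸ Γ.lat j) = F ((c t * g : Heis) : Heis ⧸ Γ.lat j)
    congr 1
    refine (QuotientGroup.eq.2 ?_).symm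
    rw [c_add, mul_assoc, c_comm r g, ← mul_assoc (c t), inv_mul_cancel_left]
    exact (hb.center r).2 ⟨1, by simp⟩
  have hΦc (q : Heis ⧸ Γ.lat j) (u : ℝ) : Φ (c u • q) = Φ q := by
    simp only [Φ, smul_smul, ← c_add]
    rw [intervalIntegral.integral_comp_add_right (fun t => F (c t • q))]
    have := (hper q).intervalIntegral_add_eq u 0
    simpa [add_comm] using this
  -- Modulo the lattice, `γ * g` equals `γ * g * γ⁻¹`, which is `g` multiplied by a central
  -- commutator.
  have hΦγ {γ : Heis} (hγ : γ ∈ Γ.lat j) (q : Heis ⧸ Γ.lat j) : Φ (γ • q) = Φ q := by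
    induction q using QuotientGroup.induction_on with | H g => ?_
    rw [← hΦc (g : Heis ⧸ Γ.lat j) (γ.x * g.y - g.x * γ.y)]
    congr 1
    refine QuotientGroup.eq.2 ?_
    rw [← commutator_eq]
    convert (Γ.lat j).inv_mem hγ using 1
    simp only [smul_eq_mul]
    group
  have hΦ : ∫ x, Φ (x.coord j) * f x ∂μ ≠ 0 := by
    have hc (t : ℝ) : ∫ x, F (c t • x.coord j) * f x ∂μ = ∫ x, F (x.coord j) * f x ∂μ := by
      have := eigenfunction_integral_smul (hfg (c t) trivial) j F
      simpa [unitExp_zero] using this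
    have hmeas : Measurable fun q : ℝ × OdometerSpace Γ => F (c q.1 • q.2.coord j) * f q.2 :=
      (hF.comp (hb.measurable_smul.comp ((continuous_c.measurable.comp measurable_fst).prodMk
        ((OdometerSpace.measurable_coord j).comp measurable_snd)))).mul (hf.comp measurable_snd)
    have hswap : ∫ x, Φ (x.coord j) * f x ∂μ =
        ∫ t in (0 : ℝ)..r, ∫ x, F (c t • x.coord j) * f x ∂μ := by
      simp only [Φ, ← intervalIntegral.integral_mul_const]
      simp only [intervalIntegral.integral_of_le hr0.le]
      refine (integral_integral_swap ?_).symm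
      refine .of_bound hmeas.aestronglyMeasurable 1 (.of_forall fun q => ?_)
      simp only [Function.uncurry, norm_mul, hf1, mul_one]
      exact hF1 _
    rw [hswap]
    simp only [hc, intervalIntegral.integral_const, sub_zero]
    exact smul_ne_zero hr0.ne' hne
  refine Set.mem_iUnion.2 ⟨j, ?_⟩
  rintro _ ⟨γ, hγ, rfl⟩
  have h1 := eigenfunction_integral_smul (hfg γ trivial) j Φ
  simp only [hΦγ hγ] at h1
  exact (unitExp_eq_one_iff _).1 (mul_eq_right₀ hΦ |>.1 h1)

end Spectrum

/-! ### Invariance under isomorphism and conjugation -/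

section Invariants

variable {Γ Γ' : LatticeSeq Heis} {μ : Measure (OdometerSpace Γ)} {μ' : Measure (OdometerSpace Γ')}

theorem mem_invariantS_iff (hμ : IsOdometerMeasure Γ μ) (w : ℝ × ℝ) : w ∈ invariantS Γ ↔
    HasEigenfunction μ Set.univ fun g : Heis => unitExp (w.1 * g.x + w.2 * g.y) :=
  ⟨hasEigenfunction_of_mem_invariantS, mem_invariantS_of_hasEigenfunction hμ⟩

theorem mem_invariantXi_iff (hμ : IsOdometerMeasure Γ μ) (s : ℝ) : s ∈ invariantXi Γ ↔
    HasEigenfunction μ (Set.range c) fun g : Heis => unitExp (s * g.z) :=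
  ⟨hasEigenfunction_of_mem_invariantXi, mem_invariantXi_of_hasEigenfunction hμ⟩

/-- Isomorphic odometers have the same invariants. -/
theorem IsAssociatedWith.invariants_eq (hμ : IsOdometerMeasure Γ μ)
    (h : IsAssociatedWith μ Γ') :
    invariantS Γ = invariantS Γ' ∧ invariantXi Γ = invariantXi Γ' := by
  obtain ⟨m, hm, hiso⟩ := h
  have := hμ.2
  have := hm.2
  constructor
  · ext w
    rw [mem_invariantS_iff hμ, mem_invariantS_iff hm]
    exact ⟨fun h => h.of_measureIsomorphic hiso.symm, fun h => h.of_measureIsomorphic hiso⟩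
  · ext s
    rw [mem_invariantXi_iff hμ, mem_invariantXi_iff hm]
    exact ⟨fun h => h.of_measureIsomorphic hiso.symm, fun h => h.of_measureIsomorphic hiso⟩

theorem image_p_map_conj (Λ : Subgroup Heis) (g : Heis) :
    p '' (Λ.map (MulAut.conj g).toMonoidHom : Set Heis) = p '' (Λ : Set Heis) := by
  rw [Subgroup.coe_map, Set.image_image]
  refine Set.image_congr fun γ _ => ?_
  simp [p]

theorem c_mem_map_conj (Λ : Subgroup Heis) (g : Heis) (t : ℝ) :
    c t ∈ Λ.map (MulAut.conj g).toMonoidHom ↔ c t ∈ Λ := by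
  have hfix : (MulAut.conj g).toMonoidHom (c t) = c t := by
    simp [← c_comm]
  refine ⟨?_, fun h => ⟨c t, h, hfix⟩⟩
  rintro ⟨γ, hγ, h⟩
  rwa [← (MulAut.conj g).injective (h.trans hfix.symm)]

theorem centralGenerator_map_conj (Λ : Subgroup Heis) (g : Heis) :
    centralGenerator (Λ.map (MulAut.conj g).toMonoidHom) = centralGenerator Λ := by
  simp only [centralGenerator, c_mem_map_conj]

theorem FIsomorphic.invariants_eq (hμ : IsOdometerMeasure Γ μ) (hμ' : IsOdometerMeasure Γ' μ')
    (h : FIsomorphic Heis μ μ') :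
    invariantS Γ = invariantS Γ' ∧ invariantXi Γ = invariantXi Γ' := by
  obtain ⟨Δ, Δ', hΔ, hΔ', hconj⟩ := h
  obtain ⟨h1, h2⟩ := hΔ.invariants_eq hμ
  obtain ⟨h1', h2'⟩ := hΔ'.invariants_eq hμ'
  have h3 : invariantS Δ' = invariantS Δ := by
    refine Set.iUnion_congr fun j => ?_
    obtain ⟨g, hg⟩ := hconj j
    rw [hg, image_p_map_conj]
  have h4 : invariantXi Δ' = invariantXi Δ := by
    refine Set.iUnion_congr fun j => ?_
    obtain ⟨g, hg⟩ := hconj j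
    rw [hg, centralGenerator_map_conj]
  exact ⟨by rw [h1, h1', h3], by rw [h2, h2', h4]⟩

end Invariants

/-! ### Lattices with equal projection and center -/

section Conjugacy

/-- Two subgroups with common elements over a basis of the plane lattice are nested as soon as
their centers are. -/
theorem le_of_common_basis {Λ Λ' : Subgroup Heis} {g₁ g₂ : Heis} (h₁ : g₁ ∈ Λ) (h₂ : g₂ ∈ Λ)
    (h₁' : g₁ ∈ Λ') (h₂' : g₂ ∈ Λ')
    (hspan : ∀ γ ∈ Λ, ∃ n m : ℤ, γ.x = n * g₁.x + m * g₂.x ∧ γ.y = n * g₁.y + m * g₂.y)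
    (hc : ∀ t, c t ∈ Λ → c t ∈ Λ') : Λ ≤ Λ' := by
  intro γ hγ
  obtain ⟨n, m, hx, hy⟩ := hspan γ hγ
  have hpow : (g₁ ^ n * g₂ ^ m)⁻¹ * γ = c ((g₁ ^ n * g₂ ^ m)⁻¹ * γ).z :=
    eq_c_of_p_eq_zero (by simp [hx]) (by simp [hy])
  have hmem : (g₁ ^ n * g₂ ^ m)⁻¹ * γ ∈ Λ' := by
    rw [hpow]
    refine hc _ ?_
    rw [← hpow]
    exact Λ.mul_mem (Λ.inv_mem (Λ.mul_mem (Λ.zpow_mem h₁ n) (Λ.zpow_mem h₂ m))) hγ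
  have := Λ'.mul_mem (Λ'.mul_mem (Λ'.zpow_mem h₁' n) (Λ'.zpow_mem h₂' m)) hmem
  rwa [mul_inv_cancel_left] at this

/-- Lattices with the same projection to the plane and the same center are conjugate. -/
theorem IsLattice.exists_conj_eq {Λ Λ' : Subgroup Heis} (hΛ : IsLattice Λ)
    (hp : p '' (Λ' : Set Heis) = p '' (Λ : Set Heis)) (hc : ∀ t, c t ∈ Λ' ↔ c t ∈ Λ) :
    ∃ g : Heis, Λ' = Λ.map (MulAut.conj g).toMonoidHom := by
  obtain ⟨g₁, g₂, hb⟩ := hΛ.exists_isHeisBasis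
  obtain ⟨g₁', h₁', hp₁⟩ : p g₁ ∈ p '' (Λ' : Set Heis) := hp ▸ ⟨g₁, hb.mem₁, rfl⟩
  obtain ⟨g₂', h₂', hp₂⟩ : p g₂ ∈ p '' (Λ' : Set Heis) := hp ▸ ⟨g₂, hb.mem₂, rfl⟩
  have hx₁ : g₁'.x = g₁.x := congrArg Prod.fst hp₁
  have hy₁ : g₁'.y = g₁.y := congrArg Prod.snd hp₁
  have hx₂ : g₂'.x = g₂.x := congrArg Prod.fst hp₂
  have hy₂ : g₂'.y = g₂.y := congrArg Prod.snd hp₂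
  set D := g₁.x * g₂.y - g₂.x * g₁.y with hD
  have hD0 : D ≠ 0 := hb.det_ne
  -- Conjugation by `g` adds `g.x * γ.y - γ.x * g.y` to `γ.z`. This `g` is Cramer's solution of the
  -- two equations taking `g₁` to `g₁'` and `g₂` to `g₂'`.
  let g : Heis := ⟨((g₂'.z - g₂.z) * g₁.x - (g₁'.z - g₁.z) * g₂.x) / D,
    ((g₂'.z - g₂.z) * g₁.y - (g₁'.z - g₁.z) * g₂.y) / D, 0⟩
  have hg₁ : (MulAut.conj g).toMonoidHom g₁ = g₁' := by
    ext
    · simp [hx₁]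
    · simp [hy₁]
    · simp [g]
      field_simp
      rw [hD]
      ring
  have hg₂ : (MulAut.conj g).toMonoidHom g₂ = g₂' := by
    ext
    · simp [hx₂]
    · simp [hy₂]
    · simp [g]
      field_simp
      rw [hD]
      ring
  have hspan {M : Subgroup Heis} (hM : p '' (M : Set Heis) = p '' (Λ : Set Heis)) :
      ∀ γ ∈ M, ∃ n m : ℤ, γ.x = n * g₁'.x + m * g₂'.x ∧ γ.y = n * g₁'.y + m * g₂'.y := by
    intro γ hγ
    obtain ⟨δ, hδ, h⟩ : p γ ∈ p '' (Λ : Set Heis) := hM ▸ ⟨γ, hγ, rfl⟩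
    obtain ⟨n, m, hx, hy⟩ := hb.span δ hδ
    refine ⟨n, m, ?_, ?_⟩
    · rw [hx₁, hx₂, ← hx]
      exact (congrArg Prod.fst h).symm
    · rw [hy₁, hy₂, ← hy]
      exact (congrArg Prod.snd h).symm
  have hm₁ : g₁' ∈ Λ.map (MulAut.conj g).toMonoidHom := ⟨g₁, hb.mem₁, hg₁⟩
  have hm₂ : g₂' ∈ Λ.map (MulAut.conj g).toMonoidHom := ⟨g₂, hb.mem₂, hg₂⟩
  exact ⟨g, le_antisymm
    (le_of_common_basis h₁' h₂' hm₁ hm₂ (hspan hp) fun t ht =>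
      (c_mem_map_conj Λ g t).2 ((hc t).1 ht))
    (le_of_common_basis hm₁ hm₂ h₁' h₂' (hspan (image_p_map_conj Λ g)) fun t ht =>
      (hc t).2 ((c_mem_map_conj Λ g t).1 ht))⟩

end Conjugacy

/-! ### Interlacing two sequences with equal invariants -/

section Interlacing

variable {Γ Γ' : LatticeSeq Heis}

/-- The dual basis of `p(Γ j)` consists of two vectors, so it lies in a single `p(Γ' k)*`. Pairing
with it gives integer coordinates to all of `p(Γ' k)`. -/
theorem exists_image_p_subset (h : invariantS Γ ⊆ invariantS Γ') (j : ℕ) :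
    ∃ k₀, ∀ k, k₀ ≤ k →
      p '' (Γ'.lat k : Set Heis) ⊆ p '' (Γ.lat j : Set Heis) := by
  obtain ⟨g₁, g₂, hb⟩ := (Γ.isLattice j).exists_isHeisBasis
  set D := g₁.x * g₂.y - g₂.x * g₁.y with hD
  have hD0 : D ≠ 0 := hb.det_ne
  have hw₁ : (g₂.y / D, -g₂.x / D) ∈ invariantS Γ := by
    refine Set.mem_iUnion.2 ⟨j, ?_⟩
    rintro _ ⟨γ, hγ, rfl⟩
    obtain ⟨n, m, hx, hy⟩ := hb.span γ hγ
    refine ⟨n, ?_⟩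
    simp only [p_fst, p_snd, hx, hy]
    field_simp
    rw [hD]
    ring
  have hw₂ : (-g₁.y / D, g₁.x / D) ∈ invariantS Γ := by
    refine Set.mem_iUnion.2 ⟨j, ?_⟩
    rintro _ ⟨γ, hγ, rfl⟩
    obtain ⟨n, m, hx, hy⟩ := hb.span γ hγ
    refine ⟨m, ?_⟩
    simp only [p_fst, p_snd, hx, hy]
    field_simp
    rw [hD]
    ring
  obtain ⟨k₁, hk₁⟩ := Set.mem_iUnion.1 (h hw₁)
  obtain ⟨k₂, hk₂⟩ := Set.mem_iUnion.1 (h hw₂)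
  refine ⟨max k₁ k₂, fun k hk => ?_⟩
  rintro _ ⟨γ, hγ, rfl⟩
  obtain ⟨n, hn⟩ := hk₁ _ ⟨γ, Γ'.antitone ((le_max_left _ _).trans hk) hγ, rfl⟩
  obtain ⟨m, hm⟩ := hk₂ _ ⟨γ, Γ'.antitone ((le_max_right _ _).trans hk) hγ, rfl⟩
  refine ⟨g₁ ^ n * g₂ ^ m,
    (Γ.lat j).mul_mem ((Γ.lat j).zpow_mem hb.mem₁ n) ((Γ.lat j).zpow_mem hb.mem₂ m), ?_⟩
  simp only [p_fst, p_snd] at hn hm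
  refine Prod.ext ?_ ?_
  · simp only [p_fst, mul_x, zpow_x, ← hn, ← hm]
    field_simp
    rw [hD]
    ring
  · simp only [p_snd, mul_y, zpow_y, ← hn, ← hm]
    field_simp
    rw [hD]
    ring

/-- The inverse of the central generator at level `j` belongs to `invariantXi Γ'`, so some central
generator of `Γ'` is an integer multiple of that of `Γ.lat j`. -/
theorem exists_center_subset (h : invariantXi Γ ⊆ invariantXi Γ') (j : ℕ) :
    ∃ k₀, ∀ k, k₀ ≤ k → ∀ t, c t ∈ Γ'.lat k → c t ∈ Γ.lat j := by
  obtain ⟨g₁, g₂, hb⟩ := (Γ.isLattice j).exists_isHeisBasis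
  obtain ⟨k₀, n, hn⟩ := Set.mem_iUnion.1
    (h (Set.mem_iUnion.2 ⟨j, 1, rfl⟩ : (centralGenerator (Γ.lat j))⁻¹ * (1 : ℤ) ∈ invariantXi Γ))
  obtain ⟨g₁', g₂', hb'⟩ := (Γ'.isLattice k₀).exists_isHeisBasis
  have h0 := hb.pos.ne'
  have h0' := hb'.pos.ne'
  have hgen : centralGenerator (Γ'.lat k₀) = n * centralGenerator (Γ.lat j) := by
    push_cast at hn
    field_simp at hn
    linarith
  refine ⟨k₀, fun k hk t ht => ?_⟩
  obtain ⟨m, rfl⟩ := (hb'.center t).1 (Γ'.antitone hk ht)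
  exact (hb.center _).2 ⟨m * n, by rw [hgen]; push_cast; ring⟩

/-- The elements of `Λ` over the projection of `M`. -/
def restrictPlane (Λ M : Subgroup Heis) : Subgroup Heis where
  carrier := {γ | γ ∈ Λ ∧ ∃ δ ∈ M, p δ = p γ}
  one_mem' := ⟨Λ.one_mem, 1, M.one_mem, rfl⟩
  mul_mem' := by
    rintro a b ⟨ha, α, hα, hpα⟩ ⟨hb, β, hβ, hpβ⟩
    simp only [p, Prod.mk.injEq] at hpα hpβ
    exact ⟨Λ.mul_mem ha hb, α * β, M.mul_mem hα hβ, by simp [p, hpα, hpβ]⟩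
  inv_mem' := by
    rintro a ⟨ha, α, hα, hpα⟩
    simp only [p, Prod.mk.injEq] at hpα
    exact ⟨Λ.inv_mem ha, α⁻¹, M.inv_mem hα, by simp [p, hpα]⟩

/-- The group generated by `M` and the center of `Λ`. -/
def adjoinCenter (Λ M : Subgroup Heis) : Subgroup Heis where
  carrier := {γ | ∃ t, c t ∈ Λ ∧ γ * c t ∈ M}
  one_mem' := ⟨0, Λ.one_mem, by rw [c_zero, mul_one]; exact M.one_mem⟩
  mul_mem' := by
    rintro a b ⟨s, hs, has⟩ ⟨t, ht, hbt⟩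
    refine ⟨s + t, c_add s t ▸ Λ.mul_mem hs ht, ?_⟩
    convert M.mul_mem has hbt using 1
    rw [c_add, mul_assoc a, mul_assoc a, ← mul_assoc (c s), c_comm s b, mul_assoc]
  inv_mem' := by
    rintro a ⟨s, hs, has⟩
    refine ⟨-s, c_neg s ▸ Λ.inv_mem hs, ?_⟩
    convert M.inv_mem has using 1
    rw [mul_inv_rev, c_neg, ← c_neg, c_comm]

theorem image_p_restrictPlane {Λ M : Subgroup Heis}
    (h : p '' (M : Set Heis) ⊆ p '' (Λ : Set Heis)) :
    p '' (restrictPlane Λ M : Set Heis) = p '' (M : Set Heis) := by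
  refine Set.Subset.antisymm ?_ ?_
  · rintro _ ⟨γ, ⟨-, δ, hδ, hp⟩, rfl⟩
    exact ⟨δ, hδ, hp⟩
  · rintro _ ⟨δ, hδ, rfl⟩
    obtain ⟨γ, hγ, hp⟩ := h ⟨δ, hδ, rfl⟩
    exact ⟨γ, ⟨hγ, δ, hδ, hp.symm⟩, hp⟩

theorem c_mem_restrictPlane (Λ M : Subgroup Heis) (t : ℝ) :
    c t ∈ restrictPlane Λ M ↔ c t ∈ Λ :=
  ⟨fun h => h.1, fun h => ⟨h, 1, M.one_mem, rfl⟩⟩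

theorem le_adjoinCenter (Λ M : Subgroup Heis) : M ≤ adjoinCenter Λ M :=
  fun γ hγ => ⟨0, Λ.one_mem, by rwa [c_zero, mul_one]⟩

theorem image_p_adjoinCenter (Λ M : Subgroup Heis) :
    p '' (adjoinCenter Λ M : Set Heis) = p '' (M : Set Heis) := by
  refine Set.Subset.antisymm ?_ (Set.image_mono (le_adjoinCenter Λ M))
  rintro _ ⟨γ, ⟨t, -, hγ⟩, rfl⟩
  exact ⟨_, hγ, by simp [p]⟩

theorem c_mem_adjoinCenter {Λ M : Subgroup Heis} (h : ∀ t, c t ∈ M → c t ∈ Λ) (t : ℝ) :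
    c t ∈ adjoinCenter Λ M ↔ c t ∈ Λ := by
  constructor
  · rintro ⟨s, hs, hst⟩
    rw [← c_add] at hst
    have := Λ.mul_mem (h _ hst) (Λ.inv_mem hs)
    rwa [c_add, mul_inv_cancel_right] at this
  · intro ht
    exact ⟨-t, c_neg t ▸ Λ.inv_mem ht, by rw [c_neg, mul_inv_cancel]; exact M.one_mem⟩

theorem adjoinCenter_le {Λ M N : Subgroup Heis} (hM : M ≤ N) (h : ∀ t, c t ∈ Λ → c t ∈ N) :
    adjoinCenter Λ M ≤ N := by
  rintro γ ⟨t, ht, hγ⟩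
  have := N.mul_mem (hM hγ) (N.inv_mem (h t ht))
  rwa [mul_inv_cancel_right] at this

theorem le_restrictPlane {Λ M N : Subgroup Heis} (hΛ : N ≤ Λ)
    (h : p '' (N : Set Heis) ⊆ p '' (M : Set Heis)) : N ≤ restrictPlane Λ M :=
  fun γ hγ => ⟨hΛ hγ, h ⟨γ, hγ, rfl⟩⟩

theorem exists_interlacing_sequence (hS : invariantS Γ = invariantS Γ')
    (hξ : invariantXi Γ = invariantXi Γ') : ∃ a : ℕ → ℕ, StrictMono a ∧ ∀ n,
      p '' (Γ'.lat (a (n + 1)) : Set Heis) ⊆ p '' (Γ.lat (a n) : Set Heis) ∧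
      p '' (Γ.lat (a (n + 1)) : Set Heis) ⊆ p '' (Γ'.lat (a n) : Set Heis) ∧
      (∀ t, c t ∈ Γ'.lat (a (n + 1)) → c t ∈ Γ.lat (a n)) ∧
      ∀ t, c t ∈ Γ.lat (a (n + 1)) → c t ∈ Γ'.lat (a n) := by
  choose k₁ h₁ using exists_image_p_subset hS.le
  choose k₂ h₂ using exists_image_p_subset hS.ge
  choose k₃ h₃ using exists_center_subset hξ.le
  choose k₄ h₄ using exists_center_subset hξ.ge
  -- The sum dominates all four thresholds, and `j + 1` makes the iteration strictly increasing.
  let N : ℕ → ℕ := fun j => k₁ j + k₂ j + k₃ j + k₄ j + j + 1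
  let a : ℕ → ℕ := fun n => N^[n] 0
  have ha (n : ℕ) : a (n + 1) = N (a n) := Function.iterate_succ_apply' N n 0
  refine ⟨a, strictMono_nat_of_lt_succ fun n => ?_, fun n => ⟨?_, ?_, ?_, ?_⟩⟩
  · rw [ha]
    simp only [N]
    omega
  · exact h₁ _ _ (by rw [ha]; simp only [N]; omega)
  · exact h₂ _ _ (by rw [ha]; simp only [N]; omega)
  · exact h₃ _ _ (by rw [ha]; simp only [N]; omega)
  · exact h₄ _ _ (by rw [ha]; simp only [N]; omega)

/-- At stage `n` both new lattices have the projection of `Γ'.lat (a (2 * n + 2))` and the center of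
`Γ.lat (a (2 * n + 1))`. The first lies between `Γ.lat (a (2 * n + 3))` and `Γ.lat (a (2 * n + 1))`,
the second between `Γ'.lat (a (2 * n + 2))` and `Γ'.lat (a (2 * n))`. -/
theorem fIsomorphic_of_invariants_eq {μ : Measure (OdometerSpace Γ)}
    {μ' : Measure (OdometerSpace Γ')} (hμ : IsOdometerMeasure Γ μ)
    (hμ' : IsOdometerMeasure Γ' μ') (hS : invariantS Γ = invariantS Γ')
    (hξ : invariantXi Γ = invariantXi Γ') : FIsomorphic Heis μ μ' := by
  obtain ⟨a, hmono, ha⟩ := exists_interlacing_sequence hS hξ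
  have hle (n m : ℕ) (h : n ≤ m) : n ≤ a m := h.trans (hmono.id_le m)
  obtain ⟨Δ, hΔ, hassoc⟩ := exists_isAssociatedWith_of_interlaced hμ
    (fun n => restrictPlane (Γ.lat (a (2 * n + 1))) (Γ'.lat (a (2 * n + 2))))
    (fun n => a (2 * n + 1)) (fun n => hle _ _ (by omega)) (fun n γ hγ => hγ.1)
    (fun n => le_restrictPlane (Γ.antitone (hmono.monotone (by omega)))
      (ha (2 * n + 2)).2.1)
  obtain ⟨Δ', hΔ', hassoc'⟩ := exists_isAssociatedWith_of_interlaced hμ'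
    (fun n => adjoinCenter (Γ.lat (a (2 * n + 1))) (Γ'.lat (a (2 * n + 2))))
    (fun n => a (2 * n)) (fun n => hle _ _ (by omega))
    (fun n => adjoinCenter_le (Γ'.antitone (hmono.monotone (by omega))) (ha (2 * n)).2.2.2)
    (fun n => le_adjoinCenter _ _)
  refine ⟨Δ, Δ', hassoc, hassoc', fun j => (Δ.isLattice j).exists_conj_eq ?_ fun t => ?_⟩
  · rw [hΔ, hΔ', image_p_restrictPlane (ha (2 * j + 1)).1, image_p_adjoinCenter]
  · rw [hΔ, hΔ', c_mem_restrictPlane, c_mem_adjoinCenter (ha (2 * j + 1)).2.2.1]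

end Interlacing

theorem theorem5p7 (Γ Γ' : LatticeSeq Heis)
    (μ : Measure (OdometerSpace Γ)) (hμ : IsOdometerMeasure Γ μ)
    (μ' : Measure (OdometerSpace Γ')) (hμ' : IsOdometerMeasure Γ' μ') :
    FIsomorphic Heis μ μ' ↔
      (invariantS Γ = invariantS Γ' ∧ invariantXi Γ = invariantXi Γ') :=
  ⟨fun h => h.invariants_eq hμ hμ', fun h => fIsomorphic_of_invariants_eq hμ hμ' h.1 h.2⟩
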